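/- For a finite simple graph $G$ and an integer $t\ge 0$, let $i_t(G)$ denote the number of independent sets of size $t$ in $G$, and let $K_{a,b}$ be the complete bipartite graph with partite sets of sizes $a$ and $b$. Let $G$ be a graph with $n$ vertices and minimum degree exactly $\delta$. Equality of graphs below means isomorphism. 1. If $\delta=2$ and $t\ge 3$, then $i_t(G)\le i_t(K_{2,n-2})$. If moreover $n\ge 5$ and $3\le t\le n-2$, then equality holds if and only if $G=K_{2,n-2}$ or $G$ is the graph obtained from $K_{2,n-2}$ by joining the two vertices of the partite set of size $2$ by an edge. 2. If $\delta=3$ and $t\ge 3$, then $i_t(G)\le i_t(K_{3,n-3})$. If moreover $n\ge 6$ and $t=3$, then equality holds if and only if $G=K_{3,n-3}$. If $n\ge 7$ and $4\le t\le n-3$, then equality holds if and only if $G$ is obtained from $K_{3,n-3}$ by adding some (possibly no) edges inside the partite set of size $3$. 3. If $\delta\ge 3$ and $t\ge 2\delta+1$, then $i_t(G)\le i_t(K_{\delta,n-\delta})$. If moreover $n\ge 3\delta+1$ and $2\delta+1\le t\le n-\delta$, then equality holds if and only if $G$ is obtained from $K_{\delta,n-\delta}$ by adding some (possibly no) edges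 inside the partite set of size $\delta$. -/

import Mathlib

/-- `i_t(G)`: the number of independent sets of size `t` in the graph `G`. -/
noncomputable def indepCount {V : Type*} (G : SimpleGraph V) (t : ℕ) : ℕ :=
  {s : Finset V | G.IsNIndepSet t s}.ncard

/-- The complete bipartite graph `K_{a,b}`. -/
abbrev completeBip (a b : ℕ) : SimpleGraph (Fin a ⊕ Fin b) :=
  completeBipartiteGraph (Fin a) (Fin b)

/-- The graph obtained from `K_{a,b}` by adding the edges of the graph `F` inside
the partite set of size `a`. -/
def completeBipPlus {a : ℕ} (F : SimpleGraph (Fin a)) (b : ℕ) : SimpleGraph (Fin a ⊕ Fin b) :=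
  completeBip a b ⊔ F.map Function.Embedding.inl

section Counting

open Finset
open scoped Classical

/-! Put m = n - δ, so every vertex has fewer than m non-neighbours. For a vertex set S of size m + δ
with this property, `FixedSizeBound` asks that i_t(S) ≤ C(m,t) + C(δ,t), with equality only if S
contains an independent m-set. Each vertex of such an m-set has used up its non-neighbours inside
it, so it is joined to everything outside, which fixes the extremal graphs.

The bound is proved by induction on δ. If deleting a vertex v loses at most C(δ-1,t-1) independent
sets, Pascal's rule closes the step (`FixedSizeBound.of_erase`). For t = 3 this happens when some v
has fewer than δ non-neighbours; otherwise all non-degrees lie between δ and m-1, and Goodman's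
bound gives a strict inequality (`fixedSizeBound_three`). Once t > δ, the term C(δ,t) vanishes and
the bound passes from t to t+1, because an independent t-set has at most m-t extensions. This
settles δ ≤ 2. For δ = 3 the Goodman slack at t = 3 absorbs the extra C(3,3) = 1.

For t ≥ 2δ+1, unless some vertex lies in no independent t-set and can be deleted freely, the
independent (t-1)-sets among the non-neighbours of each v are bounded by a linear function of the
independent pairs there (`card_indepSets_mul_sub_le`). Summing over v bounds i_t by a linear
function of i_3, and the case t = 3 finishes (`fixedSizeBound_of_two_mul_lt`). -/

/-- The vertices of `S` other than `v` that are not adjacent to `v`. -/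
noncomputable def nonNbrs {V : Type*} (G : SimpleGraph V) (S : Finset V) (v : V) : Finset V :=
  {w ∈ S | w ≠ v ∧ ¬ G.Adj v w}

/-- The independent sets of size `t` contained in `S`. -/
noncomputable def indepSets {V : Type*} (G : SimpleGraph V) (S : Finset V) (t : ℕ) :
    Finset (Finset V) :=
  {s ∈ S.powersetCard t | G.IsIndepSet (s : Set V)}

variable {V : Type*} {G : SimpleGraph V} {S T : Finset V} {t m D δ : ℕ} {v w : V}

/-! ### Recursions and ratio bounds for independent sets inside a vertex set. -/

lemma mem_nonNbrs : w ∈ nonNbrs G S v ↔ w ∈ S ∧ w ≠ v ∧ ¬ G.Adj v w := by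
  simp [nonNbrs]

lemma mem_indepSets {s : Finset V} :
    s ∈ indepSets G S t ↔ s ⊆ S ∧ #s = t ∧ G.IsIndepSet (s : Set V) := by
  simp [indepSets, mem_powersetCard, and_assoc]

lemma nonNbrs_subset : nonNbrs G S v ⊆ S := filter_subset _ _

lemma nonNbrs_mono (h : S ⊆ T) : nonNbrs G S v ⊆ nonNbrs G T v := filter_subset_filter _ h

lemma card_nonNbrs_lt (hv : v ∈ S) : #(nonNbrs G S v) < #S :=
  card_lt_card <| (ssubset_iff_of_subset nonNbrs_subset).2 ⟨v, hv, by simp [mem_nonNbrs]⟩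

lemma indepSets_mono (h : S ⊆ T) : indepSets G S t ⊆ indepSets G T t := fun s hs => by
  rw [mem_indepSets] at *
  exact ⟨hs.1.trans h, hs.2⟩

lemma card_indepSets_le_choose : #(indepSets G S t) ≤ (#S).choose t := by
  rw [← card_powersetCard]
  exact card_filter_le _ _

lemma card_indepSets_zero : #(indepSets G S 0) = 1 := by
  have : indepSets G S 0 = {∅} := by
    ext s
    simp only [mem_indepSets, card_eq_zero, mem_singleton]
    constructor
    · exact fun h => h.2.1
    · rintro rfl
      simp [SimpleGraph.IsIndepSet]
  simp [this]

lemma isIndepSet_insert_iff {s : Finset V} (hv : v ∉ s) :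
    G.IsIndepSet ((insert v s : Finset V) : Set V) ↔
      G.IsIndepSet (s : Set V) ∧ ∀ w ∈ s, ¬ G.Adj v w := by
  have : Std.Symm fun x y => ¬ G.Adj x y := ⟨fun _ _ h h' => h h'.symm⟩
  rw [coe_insert, SimpleGraph.IsIndepSet,
    Set.pairwise_insert_of_symm_of_notMem (by simpa using hv)]
  simp [SimpleGraph.IsIndepSet]

lemma card_indepSets_filter_mem (hv : v ∈ S) :
    #{s ∈ indepSets G S (t + 1) | v ∈ s} = #(indepSets G (nonNbrs G S v) t) := by
  refine card_bij' (fun s _ => s.erase v) (fun s _ => insert v s) ?_ ?_ ?_ ?_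
  · intro s hs
    rw [mem_filter, mem_indepSets] at hs
    obtain ⟨⟨hsS, hc, hi⟩, hvs⟩ := hs
    rw [mem_indepSets]
    rw [← insert_erase hvs, isIndepSet_insert_iff (notMem_erase v s)] at hi
    refine ⟨fun w hw => ?_, by rw [card_erase_of_mem hvs, hc]; rfl, hi.1⟩
    exact mem_nonNbrs.2 ⟨hsS (mem_of_mem_erase hw), ne_of_mem_erase hw, hi.2 w hw⟩
  · intro s hs
    rw [mem_indepSets] at hs
    obtain ⟨hsS, hc, hi⟩ := hs
    have hvs : v ∉ s := fun h => (mem_nonNbrs.1 (hsS h)).2.1 rfl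
    rw [mem_filter, mem_indepSets, isIndepSet_insert_iff hvs, card_insert_of_notMem hvs, hc]
    exact ⟨⟨insert_subset hv (hsS.trans nonNbrs_subset), rfl, hi,
      fun w hw => (mem_nonNbrs.1 (hsS hw)).2.2⟩, mem_insert_self _ _⟩
  · intro s hs
    exact insert_erase (mem_filter.1 hs).2
  · intro s hs
    rw [mem_indepSets] at hs
    exact erase_insert fun h => (mem_nonNbrs.1 (hs.1 h)).2.1 rfl

lemma card_indepSets_succ_eq (hv : v ∈ S) :
    #(indepSets G S (t + 1)) =
      #(indepSets G (S.erase v) (t + 1)) + #(indepSets G (nonNbrs G S v) t) := by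
  rw [← card_indepSets_filter_mem hv,
    ← card_filter_add_card_filter_not (s := indepSets G S (t + 1)) (fun s => v ∈ s), add_comm]
  congr 2
  ext s
  simp only [mem_filter, mem_indepSets, subset_erase]
  tauto

/-- Double counting of pairs (vertex, independent set containing it); this is the tool for every
averaging argument below. -/
lemma sum_card_indepSets_nonNbrs :
    ∑ v ∈ S, #(indepSets G (nonNbrs G S v) t) = (t + 1) * #(indepSets G S (t + 1)) := by
  have h := sum_card_bipartiteAbove_eq_sum_card_bipartiteBelow (s := S)
    (t := indepSets G S (t + 1)) (fun v s => v ∈ s)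
  rw [← sum_congr rfl fun v hv => card_indepSets_filter_mem (t := t) (G := G) hv]
  refine h.trans ?_
  rw [mul_comm, ← smul_eq_mul, ← sum_const]
  refine sum_congr rfl fun s hs => ?_
  rw [mem_indepSets] at hs
  rw [← hs.2.1, bipartiteBelow]
  congr 1
  ext w
  simpa using fun hw => hs.1 hw

lemma card_indepSets_one : #(indepSets G S 1) = #S := by
  have := sum_card_indepSets_nonNbrs (G := G) (S := S) (t := 0)
  simpa [card_indepSets_zero] using this.symm

lemma two_mul_card_indepSets_two : 2 * #(indepSets G S 2) = ∑ v ∈ S, #(nonNbrs G S v) := by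
  simpa [card_indepSets_one] using (sum_card_indepSets_nonNbrs (G := G) (S := S) (t := 1)).symm

lemma succ_mul_card_indepSets_succ_le (hS : #S ≤ D) :
    (t + 1) * #(indepSets G S (t + 1)) ≤ #(indepSets G S t) * (D - t) := by
  induction t generalizing S D with
  | zero => simpa [card_indepSets_one, card_indepSets_zero]
  | succ t ih =>
    have key : ∀ v ∈ S, (t + 1) * #(indepSets G (nonNbrs G S v) (t + 1)) ≤
        #(indepSets G (nonNbrs G S v) t) * (D - (t + 1)) := fun v hv => by
      have := ih (S := nonNbrs G S v) (D := D - 1) (by have := card_nonNbrs_lt (G := G) hv; omega)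
      rwa [Nat.sub_sub, add_comm 1] at this
    have := sum_le_sum key
    rw [← mul_sum, ← sum_mul, sum_card_indepSets_nonNbrs, sum_card_indepSets_nonNbrs] at this
    refine le_of_mul_le_mul_left (a := t + 1) ?_ t.succ_pos
    linarith

/-- A nonempty independent set lies in one of its members together with that member's
non-neighbours, at most m vertices, so m replaces the size of S. -/
lemma succ_mul_card_indepSets_succ_le_of_nonNbrs (hS : ∀ v ∈ S, #(nonNbrs G S v) < m)
    (ht : 1 ≤ t) :
    (t + 1) * #(indepSets G S (t + 1)) ≤ #(indepSets G S t) * (m - t) := by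
  obtain ⟨t, rfl⟩ := Nat.exists_eq_add_of_le' ht
  have key : ∀ v ∈ S, (t + 1) * #(indepSets G (nonNbrs G S v) (t + 1)) ≤
      #(indepSets G (nonNbrs G S v) t) * (m - (t + 1)) := fun v hv => by
    have := succ_mul_card_indepSets_succ_le (G := G) (S := nonNbrs G S v) (D := m - 1) (t := t)
      (by have := hS v hv; omega)
    rwa [Nat.sub_sub, add_comm 1] at this
  have := sum_le_sum key
  rw [← mul_sum, ← sum_mul, sum_card_indepSets_nonNbrs, sum_card_indepSets_nonNbrs] at this
  refine le_of_mul_le_mul_left (a := t + 1) ?_ t.succ_pos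
  linarith

/-- The normalized counts i_s / C(D,s) are nonincreasing in s. -/
lemma card_indepSets_mul_choose_le (hS : #S ≤ D) (r s : ℕ) (hrs : r ≤ s) (hs : s ≤ D) :
    #(indepSets G S s) * D.choose r ≤ #(indepSets G S r) * D.choose s := by
  induction s, hrs using Nat.le_induction with
  | base => rfl
  | succ s hrs ih =>
    have h1 := succ_mul_card_indepSets_succ_le (G := G) (t := s) hS
    have h2 := ih (by omega)
    have h3 := Nat.choose_succ_right_eq D s
    refine le_of_mul_le_mul_left (a := s + 1) ?_ s.succ_pos
    calc (s + 1) * (#(indepSets G S (s + 1)) * D.choose r)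
        = ((s + 1) * #(indepSets G S (s + 1))) * D.choose r := by ring
      _ ≤ (#(indepSets G S s) * (D - s)) * D.choose r := by gcongr
      _ = (#(indepSets G S s) * D.choose r) * (D - s) := by ring
      _ ≤ (#(indepSets G S r) * D.choose s) * (D - s) := by gcongr
      _ = #(indepSets G S r) * (D.choose s * (D - s)) := by ring
      _ = (s + 1) * (#(indepSets G S r) * D.choose (s + 1)) := by rw [← h3]; ring

lemma card_indepSets_succ_le_choose (hS : ∀ v ∈ S, #(nonNbrs G S v) < m) (ht : 1 ≤ t)
    (h : #(indepSets G S t) ≤ m.choose t) :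
    #(indepSets G S (t + 1)) ≤ m.choose (t + 1) := by
  have h1 := succ_mul_card_indepSets_succ_le_of_nonNbrs hS ht
  have h3 := Nat.choose_succ_right_eq m t
  refine le_of_mul_le_mul_left (a := t + 1) ?_ t.succ_pos
  calc _ ≤ #(indepSets G S t) * (m - t) := h1
    _ ≤ m.choose t * (m - t) := by gcongr
    _ = _ := by rw [← h3]; ring

lemma card_indepSets_succ_lt_choose (hS : ∀ v ∈ S, #(nonNbrs G S v) < m) (ht : 1 ≤ t)
    (htm : t + 1 ≤ m) (h : #(indepSets G S t) < m.choose t) :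
    #(indepSets G S (t + 1)) < m.choose (t + 1) := by
  have h1 := succ_mul_card_indepSets_succ_le_of_nonNbrs hS ht
  have h3 := Nat.choose_succ_right_eq m t
  refine Nat.lt_of_mul_lt_mul_left (a := t + 1) ?_
  calc _ ≤ #(indepSets G S t) * (m - t) := h1
    _ < m.choose t * (m - t) := Nat.mul_lt_mul_of_pos_right h (by omega)
    _ = _ := by rw [← h3]; ring

/-! ### Goodman's bound. -/

lemma card_filter_adj_add_card_nonNbrs (hv : v ∈ S) :
    #{w ∈ S | G.Adj v w} + #(nonNbrs G S v) + 1 = #S := by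
  have h1 := card_filter_add_card_filter_not (s := S.erase v) (fun w => G.Adj v w)
  have h2 : (S.erase v).filter (fun w => G.Adj v w) = S.filter (fun w => G.Adj v w) := by
    ext w
    simp only [mem_filter, mem_erase]
    refine ⟨fun h => ⟨h.1.2, h.2⟩, fun h => ⟨⟨h.2.ne', h.1⟩, h.2⟩⟩
  have h3 : (S.erase v).filter (fun w => ¬ G.Adj v w) = nonNbrs G S v := by
    ext w
    simp only [mem_filter, mem_erase, mem_nonNbrs]
    tauto
  rw [h2, h3, card_erase_of_mem hv] at h1
  have := card_pos.2 ⟨v, hv⟩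
  omega

/-- Goodman's bound on the number of independent triples. -/
lemma six_mul_card_indepSets_three_le :
    6 * (#(indepSets G S 3) : ℤ) ≤ ∑ v ∈ S, (((#S : ℤ) - 1) * (#S - 2) -
      3 * (#{w ∈ S | G.Adj v w} : ℤ) * #(nonNbrs G S v)) := by
  -- The indicators of adjacency, non-adjacency and equality satisfy b = 1 - e - a; the triple sum
  -- of b's is expanded by substituting this for one factor at a time.
  set a : V → V → ℤ := fun x y => if G.Adj x y then 1 else 0 with ha
  set b : V → V → ℤ := fun x y => if x ≠ y ∧ ¬ G.Adj x y then 1 else 0 with hb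
  set e : V → V → ℤ := fun x y => if x = y then 1 else 0 with he
  have hbe : ∀ x y, b x y = 1 - e x y - a x y := by
    intro x y
    simp only [ha, hb, he]
    by_cases h : x = y
    · subst h; simp
    · by_cases h' : G.Adj x y <;> simp [h, h']
  have hasymm : ∀ x y, a x y = a y x := fun x y => by simp only [ha, G.adj_comm x y]
  have hesymm : ∀ x y, e x y = e y x := fun x y => by simp only [he, eq_comm (a := x)]
  have hbsymm : ∀ x y, b x y = b y x := fun x y => by rw [hbe, hbe, hasymm, hesymm]
  have hN : ∀ v, (#(nonNbrs G S v) : ℤ) = ∑ x ∈ S, b v x := by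
    intro v
    simp only [hb, nonNbrs, sum_boole, ne_comm]
  have hd : ∀ v, (#{w ∈ S | G.Adj v w} : ℤ) = ∑ x ∈ S, a v x := by
    intro v
    simp only [ha, sum_boole]
  have h6 : 6 * (#(indepSets G S 3) : ℤ) =
      ∑ v ∈ S, ∑ x ∈ S, ∑ y ∈ S, b v x * b v y * b x y := by
    have h1 : 6 * #(indepSets G S 3) =
        ∑ v ∈ S, ∑ x ∈ nonNbrs G S v, #(nonNbrs G (nonNbrs G S v) x) := by
      rw [show 6 * #(indepSets G S 3) = 2 * ((2 + 1) * #(indepSets G S (2 + 1))) by ring,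
        ← sum_card_indepSets_nonNbrs, mul_sum]
      exact sum_congr rfl fun v _ => two_mul_card_indepSets_two
    have h2 := congrArg (Nat.cast : ℕ → ℤ) h1
    push_cast at h2
    rw [h2]
    refine sum_congr rfl fun v _ => ?_
    rw [nonNbrs, sum_filter]
    refine sum_congr rfl fun x _ => ?_
    rw [← nonNbrs]
    by_cases hx : x ≠ v ∧ ¬ G.Adj v x
    · rw [if_pos hx]
      have : b v x = 1 := if_pos ⟨hx.1.symm, hx.2⟩
      simp only [this, one_mul]
      rw [nonNbrs, nonNbrs, filter_filter, ← sum_boole]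
      refine sum_congr rfl fun y _ => ?_
      simp only [hb]
      rw [ite_zero_mul_ite_zero, mul_one]
      simp only [ne_comm]
    · rw [if_neg hx]
      have : b v x = 0 := if_neg fun h => hx ⟨h.1.symm, h.2⟩
      simp [this]
  have hS : ∀ v ∈ S, ∀ f : V → ℤ, ∑ x ∈ S, e v x * f x = f v := by
    intro v hv f
    simp only [he, ite_mul, one_mul, zero_mul, sum_ite_eq, if_pos hv]
  set A : V → ℤ := fun v => ∑ x ∈ S, a v x with hA
  set B : V → ℤ := fun v => ∑ x ∈ S, b v x with hB
  have hbb : ∀ x y, b x y * b x y = b x y := fun x y => by simp only [hb]; split_ifs <;> simp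
  have haa : ∀ x y, a x y * a x y = a x y := fun x y => by simp only [ha]; split_ifs <;> simp
  have hab : ∀ x y, a x y * b x y = 0 := fun x y => by
    simp only [ha, hb]; split_ifs with h h' <;> simp
    exact h'.2 h
  have ha0 : ∀ x y, 0 ≤ a x y := fun x y => by simp only [ha]; split_ifs <;> simp
  have h7 : ∑ v ∈ S, ∑ x ∈ S, ∑ y ∈ S, b v x * b v y * b x y =
      ∑ v ∈ S, (B v * B v - B v) - ∑ v ∈ S, ∑ x ∈ S, ∑ y ∈ S, b v x * b v y * a x y := by
    rw [← sum_sub_distrib]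
    refine sum_congr rfl fun v _ => ?_
    have h1 : ∀ x ∈ S, ∑ y ∈ S, b v x * b v y * b x y =
        b v x * B v - b v x - ∑ y ∈ S, b v x * b v y * a x y := by
      intro x hx
      rw [eq_sub_iff_add_eq, ← sum_add_distrib]
      have : ∀ y ∈ S, b v x * b v y * b x y + b v x * b v y * a x y =
          b v x * b v y - e x y * (b v x * b v y) := fun y _ => by rw [hbe x y]; ring
      rw [sum_congr rfl this, sum_sub_distrib, hS x hx, hbb, ← mul_sum]
    rw [sum_congr rfl h1, sum_sub_distrib, sum_sub_distrib, ← sum_mul]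
  have h8 : ∑ v ∈ S, ∑ x ∈ S, ∑ y ∈ S, b v x * b v y * a x y =
      ∑ x ∈ S, A x * B x - ∑ y ∈ S, ∑ x ∈ S, ∑ v ∈ S, a y x * a y v * b x v := by
    have h1 : ∑ y ∈ S, ∑ x ∈ S, ∑ v ∈ S, a y x * a y v * b x v =
        ∑ x ∈ S, ∑ v ∈ S, ∑ y ∈ S, a y x * a y v * b x v := by
      rw [sum_comm]
      exact sum_congr rfl fun x _ => sum_comm
    rw [h1, sum_comm, eq_sub_iff_add_eq, ← sum_add_distrib]
    refine sum_congr rfl fun x hx => ?_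
    rw [← sum_add_distrib, hA, hB, sum_mul_sum, sum_comm (f := fun i j => a x i * b x j)]
    refine sum_congr rfl fun v hv => ?_
    rw [← sum_add_distrib]
    have : ∀ y ∈ S, b v x * b v y * a x y + a y x * a y v * b x v =
        a x y * b x v - e v y * (a x y * b x y) := by
      intro y _
      have h2 : e v y * (a x y * b x y) = e v y * (a x y * b x v) := by
        simp only [he]; split_ifs with h
        · rw [h]
        · simp
      rw [h2, hbe v y, hbsymm v x, hasymm y x, hasymm y v]
      ring
    rw [sum_congr rfl this, sum_sub_distrib, hS v hv, hab, sub_zero]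
  have h9 : ∑ y ∈ S, ∑ x ∈ S, ∑ v ∈ S, a y x * a y v * b x v ≤
      ∑ y ∈ S, (A y * A y - A y) := by
    refine sum_le_sum fun y _ => ?_
    have h1 : ∀ x ∈ S, ∑ v ∈ S, a y x * a y v * b x v ≤ a y x * A y - a y x := by
      intro x hx
      calc _ ≤ ∑ v ∈ S, (a y x * a y v - e x v * (a y x * a y v)) := by
            refine sum_le_sum fun v _ => ?_
            rw [hbe x v]
            -- The only loss in the argument: the term counting triangles is dropped.
            nlinarith [mul_nonneg (mul_nonneg (ha0 y x) (ha0 y v)) (ha0 x v)]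
        _ = _ := by rw [sum_sub_distrib, hS x hx, haa, ← mul_sum]
    refine (sum_le_sum h1).trans_eq ?_
    rw [sum_sub_distrib, ← sum_mul]
  rw [h6, h7, h8]
  calc _ ≤ ∑ v ∈ S, (B v * B v - B v) - (∑ x ∈ S, A x * B x - ∑ y ∈ S, (A y * A y - A y)) := by
        linarith
    _ = ∑ v ∈ S, (B v * B v - B v - (A v * B v - (A v * A v - A v))) := by
        simp only [sum_sub_distrib]
    _ = _ := by
        refine sum_congr rfl fun v hv => ?_
        have h1 := card_filter_adj_add_card_nonNbrs (G := G) hv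
        rw [hd v, hN v]
        have h2 : A v + B v + 1 = (#S : ℤ) := by
          simp only [hA, hB]
          rw [← hd v, ← hN v]
          exact_mod_cast h1
        change _ = _ - 3 * A v * B v
        rw [← h2]
        ring

lemma two_mul_choose_two (n : ℕ) : 2 * (n.choose 2 : ℤ) = n * (n - 1) := by
  induction n with
  | zero => simp
  | succ n ih =>
    rw [Nat.choose_succ_succ' n 1, Nat.choose_one_right]
    push_cast
    linarith

lemma six_mul_choose_three (n : ℕ) : 6 * (n.choose 3 : ℤ) = n * (n - 1) * (n - 2) := by
  induction n with
  | zero => simp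
  | succ n ih =>
    have h2 := two_mul_choose_two n
    rw [Nat.choose_succ_succ' n 2]
    push_cast
    linarith

/-- Goodman's bound when every vertex has at least `δ` neighbours and `δ` non-neighbours. -/
lemma card_indepSets_three_le_of_le_card_nonNbrs (hS : #S = m + δ)
    (h : ∀ v ∈ S, #(nonNbrs G S v) < m) (h' : ∀ v ∈ S, δ ≤ #(nonNbrs G S v)) :
    2 * (#(indepSets G S 3) : ℤ) + δ * (m - δ) ≤ 2 * (m.choose 3 + δ.choose 3) := by
  have h1 := six_mul_card_indepSets_three_le (G := G) (S := S)
  have h2 : ∀ v ∈ S, ((#S : ℤ) - 1) * (#S - 2) -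
      3 * (#{w ∈ S | G.Adj v w} : ℤ) * #(nonNbrs G S v) ≤
      ((m : ℤ) + δ - 1) * (m + δ - 2) - 3 * δ * (m - 1) := by
    intro v hv
    have e1 := card_filter_adj_add_card_nonNbrs (G := G) hv
    have e2 := h v hv
    have e3 := h' v hv
    rw [hS] at e1 ⊢
    generalize #(nonNbrs G S v) = y at *
    generalize #{w ∈ S | G.Adj v w} = x at *
    zify at *
    have e4 : (x : ℤ) = m + δ - 1 - y := by linarith
    rw [e4]
    -- Degree times non-degree is concave in y, hence minimal at the endpoints y = δ and y = m - 1,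
    -- where it equals δ(m - 1).
    nlinarith [mul_nonneg (sub_nonneg.2 e3) (show (0 : ℤ) ≤ m - 1 - y by linarith)]
  have h3 := h1.trans (sum_le_sum h2)
  rw [sum_const, hS, nsmul_eq_mul] at h3
  push_cast at h3
  have := six_mul_choose_three m
  have := six_mul_choose_three δ
  nlinarith

/-! ### The bound for triples and its propagation to larger sets. -/

/-- `FixedSizeBound G S m δ t`: the count of independent `t`-sets in `S` is at most that of
`K_{δ,m}`, with equality only if `S` contains an independent set of size `m`. -/
def FixedSizeBound (G : SimpleGraph V) (S : Finset V) (m δ t : ℕ) : Prop :=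
  #(indepSets G S t) ≤ m.choose t + δ.choose t ∧
    (#(indepSets G S t) = m.choose t + δ.choose t → (indepSets G S m).Nonempty)

lemma FixedSizeBound.of_lt (h : #(indepSets G S t) < m.choose t + δ.choose t) :
    FixedSizeBound G S m δ t :=
  ⟨h.le, fun h' => absurd h' h.ne⟩

lemma FixedSizeBound.of_erase (hv : v ∈ S)
    (hc : #(indepSets G (nonNbrs G S v) t) ≤ δ.choose t)
    (h : FixedSizeBound G (S.erase v) m δ (t + 1)) :
    FixedSizeBound G S m (δ + 1) (t + 1) := by
  have h1 := card_indepSets_succ_eq (G := G) (t := t) hv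
  have h2 := Nat.choose_succ_succ' δ t
  refine ⟨by have := h.1; omega, fun he => ?_⟩
  exact (h.2 (by have := h.1; omega)).mono (indepSets_mono (erase_subset _ _))

/-- Equality makes every t-subset independent, and since t ≥ 2 each pair lies in one of them. -/
lemma fixedSizeBound_zero (hS : #S = m) (ht : 2 ≤ t) (htm : t ≤ m) :
    FixedSizeBound G S m 0 t := by
  have h0 : Nat.choose 0 t = 0 := Nat.choose_eq_zero_of_lt (by omega)
  refine ⟨by rw [h0, ← hS]; exact card_indepSets_le_choose, fun he => ?_⟩
  rw [h0, add_zero, ← hS, ← card_powersetCard, indepSets, card_filter_eq_iff] at he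
  refine ⟨S, mem_indepSets.2 ⟨subset_rfl, hS, fun x hx y hy hxy => ?_⟩⟩
  obtain ⟨u, hu1, hu2, hu3⟩ := exists_subsuperset_card_eq (s := {x, y}) (t := S) (n := t)
    (by simp_all [insert_subset_iff]) (card_le_two.trans ht) (by omega)
  exact he u (mem_powersetCard.2 ⟨hu2, hu3⟩) (hu1 (by simp)) (hu1 (by simp)) hxy

lemma nonNbrs_erase_lt (h : ∀ v ∈ S, #(nonNbrs G S v) < m) (v : V) :
    ∀ w ∈ S.erase v, #(nonNbrs G (S.erase v) w) < m := fun w hw =>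
  (card_le_card (nonNbrs_mono (erase_subset _ _))).trans_lt (h w (mem_of_mem_erase hw))

theorem fixedSizeBound_three (hS : #S = m + δ) (hδ : δ ≤ m) (hm : 3 ≤ m)
    (h : ∀ v ∈ S, #(nonNbrs G S v) < m) : FixedSizeBound G S m δ 3 := by
  induction δ generalizing S with
  | zero => exact fixedSizeBound_zero hS (by omega) hm
  | succ δ ih =>
    by_cases h' : ∀ v ∈ S, δ + 1 ≤ #(nonNbrs G S v)
    · apply FixedSizeBound.of_lt
      have h1 := card_indepSets_three_le_of_le_card_nonNbrs hS h h'
      obtain ⟨v, hv⟩ : S.Nonempty := card_pos.1 (by omega)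
      have h2 := h v hv
      have h3 := h' v hv
      have h4 : (0 : ℤ) < ((δ + 1 : ℕ) : ℤ) * ((m : ℤ) - (δ + 1 : ℕ)) :=
        mul_pos (by positivity) (by omega)
      zify
      linarith
    · push Not at h'
      obtain ⟨v, hv, hlt⟩ := h'
      refine FixedSizeBound.of_erase hv ?_ (ih ?_ (by omega) (nonNbrs_erase_lt h v))
      · exact card_indepSets_le_choose.trans (Nat.choose_le_choose 2 (by omega))
      · rw [card_erase_of_mem hv, hS]; omega

lemma FixedSizeBound.succ (h : ∀ v ∈ S, #(nonNbrs G S v) < m) (ht : 1 ≤ t) (htm : t + 1 ≤ m)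
    (hδ : δ < t) (hb : FixedSizeBound G S m δ t) : FixedSizeBound G S m δ (t + 1) := by
  have h0 : δ.choose t = 0 := Nat.choose_eq_zero_of_lt hδ
  have h1 : δ.choose (t + 1) = 0 := Nat.choose_eq_zero_of_lt (by omega)
  unfold FixedSizeBound at *
  rw [h0, add_zero] at hb
  rw [h1, add_zero]
  refine ⟨card_indepSets_succ_le_choose h ht hb.1, fun he => hb.2 ?_⟩
  by_contra hne
  exact (card_indepSets_succ_lt_choose h ht htm (lt_of_le_of_ne hb.1 hne)).ne he

lemma FixedSizeBound.of_le {r : ℕ} (h : ∀ v ∈ S, #(nonNbrs G S v) < m)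
    (hrt : r ≤ t) (htm : t ≤ m) (hδ : δ < r) (hb : FixedSizeBound G S m δ r) :
    FixedSizeBound G S m δ t := by
  induction t, hrt using Nat.le_induction with
  | base => exact hb
  | succ t hrt ih => exact (ih (by omega)).succ h (by omega) htm (by omega)

theorem fixedSizeBound_of_le_two (hS : #S = m + δ) (hδ : δ ≤ 2) (ht : 3 ≤ t) (htm : t ≤ m)
    (h : ∀ v ∈ S, #(nonNbrs G S v) < m) : FixedSizeBound G S m δ t :=
  (fixedSizeBound_three hS (by omega) (by omega) h).of_le h ht htm (by omega)

theorem fixedSizeBound_of_eq_three (hS : #S = m + 3) (ht : 4 ≤ t) (htm : t ≤ m)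
    (h : ∀ v ∈ S, #(nonNbrs G S v) < m) : FixedSizeBound G S m 3 t := by
  refine FixedSizeBound.of_le (r := 4) h ht htm (by omega) ?_
  by_cases h' : ∀ v ∈ S, 3 ≤ #(nonNbrs G S v)
  · apply FixedSizeBound.of_lt
    -- The slack 3(m-3)/2 exceeds C(3,3) = 1 because m ≥ 4, so there are strictly fewer than C(m,3)
    -- independent triples.
    have h1 := card_indepSets_three_le_of_le_card_nonNbrs hS h h'
    rw [Nat.choose_self] at h1
    refine (card_indepSets_succ_lt_choose h (by omega) (by omega) ?_).trans_le le_self_add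
    zify
    have : (4 : ℤ) ≤ m := by exact_mod_cast ht.trans htm
    push_cast at h1
    linarith
  · push Not at h'
    obtain ⟨v, hv, hlt⟩ := h'
    refine FixedSizeBound.of_erase hv ?_
      (fixedSizeBound_of_le_two ?_ le_rfl (by omega) (by omega) (nonNbrs_erase_lt h v))
    · exact card_indepSets_le_choose.trans (Nat.choose_le_choose 3 (by omega))
    · rw [card_erase_of_mem hv, hS]; omega

/-! ### Independent sets controlled by independent pairs, and large t. -/

lemma card_add_two_mul_card_le_card_indepSets_two {u : V} (hu : u ∈ S)
    (hw : w ∈ nonNbrs G S u) :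
    #(indepSets G (nonNbrs G (nonNbrs G S u) w) 2) + 2 * #(nonNbrs G (nonNbrs G S u) w) + 1 ≤
      #(indepSets G S 2) := by
  have h1 := card_indepSets_succ_eq (G := G) (t := 1) hu
  have h2 := card_indepSets_succ_eq (G := G) (t := 1) hw
  rw [card_indepSets_one, one_add_one_eq_two] at h1 h2
  have h3 : #(indepSets G (nonNbrs G S u) 2) ≤ #(indepSets G (S.erase u) 2) :=
    card_le_card <| indepSets_mono fun x hx =>
      mem_erase.2 ⟨(mem_nonNbrs.1 hx).2.1, nonNbrs_subset hx⟩
  have h4 : #(indepSets G (nonNbrs G (nonNbrs G S u) w) 2) ≤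
      #(indepSets G ((nonNbrs G S u).erase w) 2) :=
    card_le_card <| indepSets_mono fun x hx =>
      mem_erase.2 ⟨(mem_nonNbrs.1 hx).2.1, nonNbrs_subset hx⟩
  have h5 := card_nonNbrs_lt (G := G) hw
  omega

/-- Fix an ordered non-adjacent pair u, w with y common non-neighbours, x independent pairs among
them. Then S has at least x + 2y + 1 independent pairs; since x ≤ C(y,2) and y ≤ D - 2, the ratio of
x to that number is at most C(D-2,2)/C(D,2). Summing over u, w counts each independent 4-set 12
times. -/
lemma card_indepSets_four_mul_le (hS : #S ≤ D) (hD : 2 ≤ D) :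
    #(indepSets G S 4) * D.choose 2 ^ 2 ≤ #(indepSets G S 2) ^ 2 * D.choose 4 := by
  obtain ⟨k, rfl⟩ := Nat.exists_eq_add_of_le' hD
  have key : ∀ u ∈ S, ∀ w ∈ nonNbrs G S u,
      #(indepSets G (nonNbrs G (nonNbrs G S u) w) 2) * (k + 2).choose 2 ≤
        #(indepSets G S 2) * k.choose 2 := by
    intro u hu w hw
    have h1 := card_add_two_mul_card_le_card_indepSets_two hu hw
    have h2 : #(nonNbrs G (nonNbrs G S u) w) ≤ k := by
      have := card_nonNbrs_lt (G := G) hu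
      have := card_nonNbrs_lt (G := G) hw
      omega
    have h3 := card_indepSets_le_choose (G := G) (S := nonNbrs G (nonNbrs G S u) w) (t := 2)
    generalize #(nonNbrs G (nonNbrs G S u) w) = y at *
    generalize #(indepSets G (nonNbrs G (nonNbrs G S u) w) 2) = x at *
    refine le_trans ?_ (Nat.mul_le_mul_right _ h1)
    have h4 := two_mul_choose_two k
    have h5 := two_mul_choose_two (k + 2)
    have h6 := two_mul_choose_two y
    obtain ⟨j, rfl⟩ := Nat.exists_eq_add_of_le h2
    zify at *
    generalize ((y.choose 2 : ℕ) : ℤ) = Y at *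
    generalize (((y + j).choose 2 : ℕ) : ℤ) = K at *
    generalize (((y + j + 2).choose 2 : ℕ) : ℤ) = L at *
    have hx : 2 * (x : ℤ) ≤ y * (y - 1) := by linarith
    -- This polynomial is (2y+1)k(k-1) - y(y-1)(2k+1) with k = y + j, the inequality left after
    -- replacing x by its maximum C(y,2).
    have hj : (0 : ℤ) ≤ j * (2 * y ^ 2 + 2 * y - 1 + j * (2 * y + 1)) := by
      rcases Nat.eq_zero_or_pos j with rfl | hj
      · simp
      · have : (1 : ℤ) ≤ j := by exact_mod_cast hj
        have hy : (0 : ℤ) ≤ y := by positivity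
        refine mul_nonneg (by positivity) ?_
        nlinarith [mul_nonneg hy hy, mul_nonneg hy (sub_nonneg.2 this)]
    have hm := mul_le_mul_of_nonneg_right hx
      (show (0 : ℤ) ≤ 2 * (y + j) + 1 by positivity)
    have e1 : 2 * (x * L) = (x : ℤ) * ((y + j + 2) * (y + j + 2 - 1)) := by rw [← h5]; ring
    have e2 : 2 * ((x + 2 * y + 1) * K) =
      ((x : ℤ) + 2 * y + 1) * ((y + j) * (y + j - 1)) := by rw [← h4]; ring
    nlinarith
  have h1 : ∀ u ∈ S, 3 * #(indepSets G (nonNbrs G S u) 3) * (k + 2).choose 2 ≤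
      #(nonNbrs G S u) * (#(indepSets G S 2) * k.choose 2) := by
    intro u hu
    have := sum_le_sum (key u hu)
    rwa [← sum_mul, sum_card_indepSets_nonNbrs, sum_const, smul_eq_mul] at this
  have h2 := sum_le_sum h1
  rw [← sum_mul, ← mul_sum, sum_card_indepSets_nonNbrs, ← sum_mul,
    ← two_mul_card_indepSets_two] at h2
  have h3 := Nat.choose_mul (n := k + 2) (k := 4) (s := 2) (by norm_num)
  simp only [Nat.add_sub_cancel, show Nat.choose 4 2 = 6 by rfl, show 4 - 2 = 2 by rfl] at h3
  refine le_of_mul_le_mul_left (a := 12) ?_ (by norm_num)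
  calc 12 * (#(indepSets G S 4) * (k + 2).choose 2 ^ 2)
      = (3 * ((3 + 1) * #(indepSets G S (3 + 1))) * (k + 2).choose 2) * (k + 2).choose 2 := by
        ring
    _ ≤ (2 * #(indepSets G S 2) * (#(indepSets G S 2) * k.choose 2)) * (k + 2).choose 2 := by
        gcongr
    _ = 2 * #(indepSets G S 2) ^ 2 * ((k + 2).choose 2 * k.choose 2) := by ring
    _ = _ := by rw [← h3]; ring

lemma choose_le_card_indepSets (h : (indepSets G S t).Nonempty) (r : ℕ) :
    t.choose r ≤ #(indepSets G S r) := by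
  obtain ⟨u, hu⟩ := h
  rw [mem_indepSets] at hu
  rw [← hu.2.1, ← card_powersetCard]
  refine card_le_card fun s hs => ?_
  rw [mem_powersetCard] at hs
  exact mem_indepSets.2 ⟨hs.1.trans hu.1, hs.2, hu.2.2.mono (by exact_mod_cast hs.1)⟩

/-- The number of independent `s`-sets is at most a linear function of the number of independent
pairs. -/
lemma card_indepSets_mul_sub_le {s c : ℕ} (hS : #S ≤ D) (hs : 4 ≤ s) (hsD : s ≤ D)
    (hne : (indepSets G S s).Nonempty) (hc : 2 * c ≤ s.choose 2) :
    (#(indepSets G S s) : ℤ) * (D.choose 2 - c) ≤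
      D.choose s * (#(indepSets G S 2) - c) := by
  have h1 := card_indepSets_mul_choose_le (G := G) hS 4 s hs hsD
  have h2 := card_indepSets_four_mul_le (G := G) hS (by omega)
  have h3 := choose_le_card_indepSets hne 2
  have h4 : #(indepSets G S 2) ≤ D.choose 2 :=
    card_indepSets_le_choose.trans (Nat.choose_le_choose 2 hS)
  have h5 : #(indepSets G S s) * D.choose 2 ^ 2 ≤ #(indepSets G S 2) ^ 2 * D.choose s := by
    refine le_of_mul_le_mul_right (a := D.choose 4) ?_ (Nat.choose_pos (by omega))
    calc _ = #(indepSets G S s) * D.choose 4 * D.choose 2 ^ 2 := by ring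
      _ ≤ #(indepSets G S 4) * D.choose s * D.choose 2 ^ 2 := by gcongr
      _ = #(indepSets G S 4) * D.choose 2 ^ 2 * D.choose s := by ring
      _ ≤ #(indepSets G S 2) ^ 2 * D.choose 4 * D.choose s := by gcongr
      _ = _ := by ring
  have h6 : 0 < D.choose 2 := Nat.choose_pos (by omega)
  generalize #(indepSets G S s) = k at *
  generalize #(indepSets G S 2) = e at *
  generalize D.choose 2 = E at *
  generalize D.choose s = K at *
  have h7 : 2 * c ≤ e := hc.trans h3
  zify at h4 h5 h6 h7
  -- The difference of the two sides factors as (E - e)(Ee - c(E + e)); the second factor is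
  -- nonnegative because 2c ≤ e ≤ E. The independent s-set serves to make e this large.
  have h8 : (e : ℤ) ^ 2 * (E - c) ≤ E ^ 2 * (e - c) := by
    have : (0 : ℤ) ≤ (E - e) * (E * e - c * (E + e)) := by
      refine mul_nonneg (by linarith) ?_
      nlinarith
    nlinarith
  have h9 : (0 : ℤ) ≤ E - c := by linarith
  refine le_of_mul_le_mul_right (a := (E : ℤ) ^ 2) ?_ (by positivity)
  calc (k : ℤ) * (E - c) * E ^ 2 = k * (E : ℤ) ^ 2 * (E - c) := by ring
    _ ≤ (e : ℤ) ^ 2 * K * (E - c) := by gcongr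
    _ = K * ((e : ℤ) ^ 2 * (E - c)) := by ring
    _ ≤ K * ((E : ℤ) ^ 2 * (e - c)) := by gcongr
    _ = _ := by ring

theorem fixedSizeBound_of_two_mul_lt (hS : #S = m + δ) (hδ : 2 * δ < t) (ht : 3 ≤ t)
    (htm : t ≤ m) (h : ∀ v ∈ S, #(nonNbrs G S v) < m) : FixedSizeBound G S m δ t := by
  induction δ generalizing S with
  | zero => exact fixedSizeBound_of_le_two hS (by omega) ht htm h
  | succ δ ih =>
    by_cases h2 : δ + 1 ≤ 2
    · exact fixedSizeBound_of_le_two hS h2 ht htm h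
    obtain ⟨s, rfl⟩ := Nat.exists_eq_add_of_le' (show 1 ≤ t by omega)
    by_cases hne : ∀ v ∈ S, (indepSets G (nonNbrs G S v) s).Nonempty
    swap
    · push Not at hne
      obtain ⟨v, hv, he⟩ := hne
      refine FixedSizeBound.of_erase hv (by simp [he])
        (ih ?_ (by omega) (nonNbrs_erase_lt h v))
      rw [card_erase_of_mem hv, hS]; omega
    -- This is where t ≥ 2δ+1 enters; in the induction step the small part has size δ + 1 and t = s
    -- + 1.
    have hc : 2 * δ.choose 2 < s.choose 2 := by
      have h3 := two_mul_choose_two δ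
      have h4 := two_mul_choose_two s
      have h5 : 2 * ((δ : ℤ) + 1) ≤ s := by omega
      zify
      nlinarith
    have key : ∀ v ∈ S, (#(indepSets G (nonNbrs G S v) s) : ℤ) *
        ((m - 1).choose 2 - δ.choose 2) ≤
        (m - 1).choose s * (#(indepSets G (nonNbrs G S v) 2) - δ.choose 2) := fun v hv =>
      card_indepSets_mul_sub_le (by have := h v hv; omega) (by omega) (by omega) (hne v hv) hc.le
    have hsum := sum_le_sum key
    rw [← sum_mul, ← mul_sum, sum_sub_distrib, sum_const, nsmul_eq_mul, hS,
      ← Nat.cast_sum, ← Nat.cast_sum, sum_card_indepSets_nonNbrs, sum_card_indepSets_nonNbrs]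
      at hsum
    have h3 := fixedSizeBound_three hS (by omega) (by omega) h
    obtain ⟨M, rfl⟩ := Nat.exists_eq_add_of_le' (show 1 ≤ m by omega)
    rw [Nat.add_sub_cancel] at hsum
    have e1 : ((M + 1 : ℕ) : ℤ) * M.choose s = (M + 1).choose (s + 1) * (s + 1 : ℕ) := by
      exact_mod_cast Nat.add_one_mul_choose_eq M s
    have e2 : ((M + 1 : ℕ) : ℤ) * M.choose 2 = (M + 1).choose 3 * (3 : ℕ) := by
      exact_mod_cast Nat.add_one_mul_choose_eq M 2
    have e3 : ((δ + 1 : ℕ) : ℤ) * δ.choose 2 = (δ + 1).choose 3 * (3 : ℕ) := by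
      exact_mod_cast Nat.add_one_mul_choose_eq δ 2
    have hE : s.choose 2 ≤ M.choose 2 := Nat.choose_le_choose 2 (by omega)
    have hK : 0 < M.choose s := Nat.choose_pos (by omega)
    have h0 : (δ + 1).choose (s + 1) = 0 := Nat.choose_eq_zero_of_lt (by omega)
    unfold FixedSizeBound at h3 ⊢
    rw [h0, add_zero]
    norm_num only at hsum
    generalize #(indepSets G S (s + 1)) = i at *
    generalize #(indepSets G S 3) = j at *
    generalize (M + 1).choose (s + 1) = Ct at *
    generalize M.choose s = K at *
    generalize (M + 1).choose 3 = A at *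
    generalize (δ + 1).choose 3 = B at *
    generalize M.choose 2 = E at *
    generalize δ.choose 2 = c at *
    generalize s.choose 2 = R at *
    obtain ⟨h3, h3'⟩ := h3
    -- The deficit in t-sets dominates a multiple of the deficit in triples. The choice c = C(δ,2)
    -- makes the constants match exactly, since (δ+1)c = 3·C(δ+1,3).
    have main : ((s + 1 : ℕ) : ℤ) * (E - c) * (Ct - i) ≥ 3 * K * (A + B - j) := by
      push_cast at *
      have e4 : (E - c : ℤ) * ((M + 1) * K) = (E - c) * (Ct * (s + 1)) := by rw [e1]
      have e5 : (K : ℤ) * ((M + 1) * E) = K * (A * 3) := by rw [e2]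
      have e6 : (K : ℤ) * ((δ + 1) * c) = K * (B * 3) := by rw [e3]
      linarith
    have hEc : (0 : ℤ) < ((s + 1 : ℕ) : ℤ) * (E - c) := by
      refine mul_pos (by positivity) ?_
      omega
    have hslack : (0 : ℤ) ≤ A + B - j := by
      zify at h3; linarith
    have hK' : (0 : ℤ) < 3 * K := by positivity
    constructor
    · have : (0 : ℤ) ≤ Ct - i :=
        nonneg_of_mul_nonneg_right ((mul_nonneg hK'.le hslack).trans main) hEc
      omega
    · rintro rfl
      refine h3' ?_
      rw [sub_self, mul_zero] at main
      have : (A + B - j : ℤ) ≤ 0 := by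
        by_contra hlt
        have := mul_pos hK' (not_le.1 hlt)
        linarith
      omega

lemma card_indepSets_eq_zero_of_lt (ht : 2 ≤ t) (hmt : m < t) (h : ∀ v ∈ S, #(nonNbrs G S v) < m) :
    #(indepSets G S t) = 0 := by
  obtain ⟨t, rfl⟩ := Nat.exists_eq_add_of_le' (show 1 ≤ t by omega)
  have h1 := sum_card_indepSets_nonNbrs (G := G) (S := S) (t := t)
  rw [sum_eq_zero fun v hv => ?_] at h1
  · simpa using h1.symm
  · refine Nat.eq_zero_of_le_zero (card_indepSets_le_choose.trans_eq ?_)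
    exact Nat.choose_eq_zero_of_lt (by have := h v hv; omega)

/-! ### Counts in the extremal graphs. -/

lemma indepCount_eq_card_indepSets [Fintype V] :
    indepCount G t = #(indepSets G univ t) := by
  rw [indepCount, ← Set.ncard_coe_finset]
  congr 1
  ext s
  simp [mem_indepSets, SimpleGraph.isNIndepSet_iff, and_comm]

lemma indepCount_congr {W : Type*} {H : SimpleGraph W} (e : G ≃g H) (t : ℕ) :
    indepCount G t = indepCount H t := by
  rw [indepCount, indepCount,
    ← Set.ncard_image_of_injective _ (Finset.map_injective e.toEquiv.toEmbedding)]
  congr 1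
  ext s
  simp only [Set.mem_image, Set.mem_ofPred_eq, SimpleGraph.isNIndepSet_iff]
  constructor
  · rintro ⟨u, ⟨hu, hc⟩, rfl⟩
    refine ⟨?_, by rw [card_map, hc]⟩
    intro x hx y hy hxy
    simp only [coe_map, Set.mem_image] at hx hy
    obtain ⟨x, hx, rfl⟩ := hx
    obtain ⟨y, hy, rfl⟩ := hy
    exact fun hadj => hu hx hy (fun h => hxy (by rw [h])) (e.map_adj_iff.1 hadj)
  · rintro ⟨hs, hc⟩
    refine ⟨s.map e.symm.toEquiv.toEmbedding, ⟨?_, by rw [card_map, hc]⟩, ?_⟩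
    · intro x hx y hy hxy
      simp only [coe_map, Set.mem_image] at hx hy
      obtain ⟨x, hx, rfl⟩ := hx
      obtain ⟨y, hy, rfl⟩ := hy
      exact fun hadj => hs hx hy (fun h => hxy (by rw [h])) (e.symm.map_adj_iff.1 hadj)
    · ext x
      simp only [mem_map]
      constructor
      · rintro ⟨_, ⟨y, hy, rfl⟩, rfl⟩
        simpa using hy
      · exact fun hx => ⟨e.symm x, ⟨x, hx, rfl⟩, by simp⟩

section CompleteBip

variable {a b : ℕ} {F : SimpleGraph (Fin a)}

lemma completeBipPlus_adj_inl_inl {x y : Fin a} :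
    (completeBipPlus F b).Adj (Sum.inl x) (Sum.inl y) ↔ F.Adj x y := by
  simp [completeBipPlus]

lemma completeBipPlus_adj_inl_inr {x : Fin a} {y : Fin b} :
    (completeBipPlus F b).Adj (Sum.inl x) (Sum.inr y) := by
  simp [completeBipPlus]

lemma not_completeBipPlus_adj_inr_inr {x y : Fin b} :
    ¬ (completeBipPlus F b).Adj (Sum.inr x) (Sum.inr y) := by
  simp [completeBipPlus]

lemma completeBipPlus_bot : completeBipPlus (⊥ : SimpleGraph (Fin a)) b = completeBip a b :=
  sup_eq_left.2 fun x y hxy => by simp [SimpleGraph.map_adj] at hxy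

lemma indepCount_completeBipPlus (ht : 1 ≤ t) :
    indepCount (completeBipPlus F b) t = b.choose t + indepCount F t := by
  have hset : {s | (completeBipPlus F b).IsNIndepSet t s} =
      Finset.map Function.Embedding.inr '' (powersetCard t (univ : Finset (Fin b)) :
        Set (Finset (Fin b))) ∪
      Finset.map Function.Embedding.inl '' {s | F.IsNIndepSet t s} := by
    ext s
    simp only [Set.mem_ofPred_eq, SimpleGraph.isNIndepSet_iff, Set.mem_union, Set.mem_image,
      mem_coe, mem_powersetCard, subset_univ, true_and]
    constructor
    · rintro ⟨hs, hc⟩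
      by_cases hl : ∃ x, Sum.inl x ∈ s
      · right
        obtain ⟨x, hx⟩ := hl
        have hmap : s.toLeft.map Function.Embedding.inl = s := by
          ext (y | y)
          · simp
          · simpa using fun hy => hs hx hy (by simp) completeBipPlus_adj_inl_inr
        refine ⟨s.toLeft, ⟨fun y hy z hz hyz hadj => ?_, ?_⟩, hmap⟩
        · exact hs (mem_toLeft.1 hy) (mem_toLeft.1 hz) (by simpa using hyz)
            (completeBipPlus_adj_inl_inl.2 hadj)
        · rw [← hc, ← hmap, card_map, hmap]
      · left
        have hmap : s.toRight.map Function.Embedding.inr = s := by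
          ext (y | y)
          · simpa using fun hy => hl ⟨y, hy⟩
          · simp
        refine ⟨s.toRight, ?_, hmap⟩
        rw [← hc, ← hmap, card_map, hmap]
    · rintro (⟨u, hc, rfl⟩ | ⟨u, ⟨hu, hc⟩, rfl⟩)
      · refine ⟨?_, by rw [card_map, hc]⟩
        intro x hx y hy _
        simp only [coe_map, Set.mem_image] at hx hy
        obtain ⟨x, _, rfl⟩ := hx
        obtain ⟨y, _, rfl⟩ := hy
        exact not_completeBipPlus_adj_inr_inr
      · refine ⟨?_, by rw [card_map, hc]⟩
        intro x hx y hy hxy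
        simp only [coe_map, Set.mem_image] at hx hy
        obtain ⟨x, hx, rfl⟩ := hx
        obtain ⟨y, hy, rfl⟩ := hy
        exact fun hadj => hu hx hy (fun h => hxy (by rw [h])) (completeBipPlus_adj_inl_inl.1 hadj)
  have hdisj : Disjoint
      (Finset.map Function.Embedding.inr '' (powersetCard t (univ : Finset (Fin b)) :
        Set (Finset (Fin b))))
      (Finset.map (Function.Embedding.inl : Fin a ↪ Fin a ⊕ Fin b) ''
        {s | F.IsNIndepSet t s}) := by
    rw [Set.disjoint_left]
    rintro _ ⟨u, hu, rfl⟩ ⟨w, _, hw⟩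
    rw [mem_coe, mem_powersetCard] at hu
    obtain ⟨x, hx⟩ : u.Nonempty := card_pos.1 (by omega)
    have : Sum.inr x ∈ w.map (Function.Embedding.inl : Fin a ↪ Fin a ⊕ Fin b) := by
      rw [hw]; simpa using hx
    simp at this
  rw [indepCount, hset, Set.ncard_union_eq hdisj (Set.toFinite _) (Set.toFinite _),
    Set.ncard_image_of_injective _ (Finset.map_injective _),
    Set.ncard_image_of_injective _ (Finset.map_injective _), Set.ncard_coe_finset,
    card_powersetCard, card_univ, Fintype.card_fin, indepCount]

lemma indepCount_completeBip (ht : 1 ≤ t) :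
    indepCount (completeBip a b) t = b.choose t + a.choose t := by
  rw [← completeBipPlus_bot, indepCount_completeBipPlus ht, indepCount_eq_card_indepSets]
  congr 1
  have hbot : indepSets (⊥ : SimpleGraph (Fin a)) univ t = powersetCard t univ := by
    ext s
    simp [mem_indepSets, mem_powersetCard, SimpleGraph.IsIndepSet, Set.Pairwise]
  rw [hbot, card_powersetCard, card_univ, Fintype.card_fin]

lemma indepCount_eq_zero_of_lt (hat : a < t) : indepCount F t = 0 := by
  rw [indepCount_eq_card_indepSets]
  refine Nat.eq_zero_of_le_zero (card_indepSets_le_choose.trans_eq ?_)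
  simpa using Nat.choose_eq_zero_of_lt hat

lemma eq_bot_of_indepCount_eq (ht : 2 ≤ t) (hta : t ≤ a) (h : indepCount F t = a.choose t) :
    F = ⊥ := by
  rw [indepCount_eq_card_indepSets] at h
  obtain ⟨s, hs⟩ := (fixedSizeBound_zero (G := F) (S := univ) (m := a) (by simp) ht hta).2
    (by rw [h, Nat.choose_eq_zero_of_lt (show 0 < t by omega), add_zero])
  rw [mem_indepSets] at hs
  have hsu : s = univ := by
    rw [← card_eq_iff_eq_univ, hs.2.1, Fintype.card_fin]
  ext x y
  simp only [SimpleGraph.bot_adj, iff_false]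
  exact fun hadj => hs.2.2 (by simp [hsu]) (by simp [hsu]) hadj.ne hadj

end CompleteBip

/-! ### Recovering the extremal graphs from equality. -/

lemma exists_iso_completeBipPlus_two_iff :
    (∃ F : SimpleGraph (Fin 2), Nonempty (G ≃g completeBipPlus F m)) ↔
      Nonempty (G ≃g completeBip 2 m) ∨
        Nonempty (G ≃g completeBipPlus (⊤ : SimpleGraph (Fin 2)) m) := by
  constructor
  · rintro ⟨F, e⟩
    by_cases hF : F.Adj 0 1
    · have : F = ⊤ := by
        ext x y
        fin_cases x <;> fin_cases y <;> simp [hF, hF.symm]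
      exact Or.inr (this ▸ e)
    · have : F = ⊥ := by
        ext x y
        fin_cases x <;> fin_cases y <;> simp [hF, F.adj_comm 1 0]
      rw [this, completeBipPlus_bot] at e
      exact Or.inl e
  · rintro (e | e)
    · exact ⟨⊥, by rwa [completeBipPlus_bot]⟩
    · exact ⟨⊤, e⟩

variable [Fintype V]

lemma exists_iso_completeBipPlus (hn : Fintype.card V = m + δ)
    (h : ∀ v, #(nonNbrs G univ v) < m) (hne : (indepSets G univ m).Nonempty) :
    ∃ F : SimpleGraph (Fin δ), Nonempty (G ≃g completeBipPlus F m) := by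
  obtain ⟨A, hA⟩ := hne
  rw [mem_indepSets] at hA
  obtain ⟨-, hc, hi⟩ := hA
  have hcross : ∀ x ∈ A, ∀ y ∉ A, G.Adj x y := by
    intro x hx y hy
    by_contra hadj
    -- A non-neighbour y outside A would give x at least m non-neighbours.
    have hsub : insert y (A.erase x) ⊆ nonNbrs G univ x := by
      intro z hz
      rw [mem_insert, mem_erase] at hz
      rcases hz with rfl | ⟨hzx, hz⟩
      · exact mem_nonNbrs.2 ⟨mem_univ _, fun he => hy (he ▸ hx), hadj⟩
      · exact mem_nonNbrs.2 ⟨mem_univ _, hzx, hi hx hz hzx.symm⟩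
    have h1 := card_le_card hsub
    rw [card_insert_of_notMem (fun hy' => hy (mem_of_mem_erase hy')), card_erase_of_mem hx] at h1
    have := h x
    omega
  let e2 : {x // x ∈ A} ≃ Fin m := Fintype.equivFinOfCardEq (by simp [hc])
  let e1 : {x // x ∉ A} ≃ Fin δ :=
    Fintype.equivFinOfCardEq (by rw [Fintype.card_subtype_compl]; simp [hn, hc])
  let e : Fin δ ⊕ Fin m ≃ V :=
    ((Equiv.sumCongr e1.symm e2.symm).trans (Equiv.sumComm _ _)).trans (Equiv.sumCompl (· ∈ A))
  have hl : ∀ i, e (Sum.inl i) = (e1.symm i : V) := fun i => rfl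
  have hr : ∀ i, e (Sum.inr i) = (e2.symm i : V) := fun i => rfl
  refine ⟨G.comap fun i => (e1.symm i : V), ⟨SimpleGraph.Iso.symm ⟨e, ?_⟩⟩⟩
  rintro (x | x) (y | y)
  · rw [completeBipPlus_adj_inl_inl, hl, hl, SimpleGraph.comap_adj]
  · rw [hl, hr]
    exact iff_of_true (hcross _ (e2.symm y).2 _ (e1.symm x).2).symm completeBipPlus_adj_inl_inr
  · rw [hl, hr]
    exact iff_of_true (hcross _ (e2.symm x).2 _ (e1.symm y).2) completeBipPlus_adj_inl_inr.symm
  · rw [hr, hr]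
    refine iff_of_false (fun hadj => ?_) not_completeBipPlus_adj_inr_inr
    exact hi (e2.symm x).2 (e2.symm y).2 hadj.ne hadj

lemma card_nonNbrs_univ_lt (G : SimpleGraph V) [DecidableRel G.Adj]
    (hδ : G.minDegree = δ) (v : V) : #(nonNbrs G univ v) < Fintype.card V - δ := by
  have h1 : G.degree v + #(nonNbrs G univ v) + 1 = Fintype.card V := by
    rw [← card_univ, ← card_filter_adj_add_card_nonNbrs (G := G) (mem_univ v),
      ← SimpleGraph.card_neighborFinset_eq_degree]
    congr 3
    ext w
    simp
  have h2 := G.minDegree_le_degree v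
  omega

lemma indepCount_le_completeBip (ht : 2 ≤ t) (h : ∀ v, #(nonNbrs G univ v) < m)
    (hb : t ≤ m → FixedSizeBound G univ m δ t) :
    indepCount G t ≤ indepCount (completeBip δ m) t := by
  rw [indepCount_completeBip (by omega), indepCount_eq_card_indepSets]
  rcases le_or_gt t m with htm | hmt
  · exact (hb htm).1
  · rw [card_indepSets_eq_zero_of_lt ht hmt fun v _ => h v]
    exact Nat.zero_le _

lemma indepCount_eq_completeBip_iff (hn : Fintype.card V = m + δ) (ht : 1 ≤ t) (hδt : δ < t)
    (h : ∀ v, #(nonNbrs G univ v) < m) (hb : FixedSizeBound G univ m δ t) :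
    indepCount G t = indepCount (completeBip δ m) t ↔
      ∃ F : SimpleGraph (Fin δ), Nonempty (G ≃g completeBipPlus F m) := by
  rw [indepCount_completeBip ht]
  constructor
  · intro he
    rw [indepCount_eq_card_indepSets] at he
    exact exists_iso_completeBipPlus hn h (hb.2 he)
  · rintro ⟨F, ⟨e⟩⟩
    rw [indepCount_congr e, indepCount_completeBipPlus ht, indepCount_eq_zero_of_lt hδt,
      Nat.choose_eq_zero_of_lt hδt]

/-- Here t ≤ δ, so the small part must contribute all its C(δ,t) subsets, and any edge inside it
would destroy some. -/
lemma indepCount_eq_completeBip_iff_of_le (hn : Fintype.card V = m + δ) (ht : 2 ≤ t)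
    (htδ : t ≤ δ) (h : ∀ v, #(nonNbrs G univ v) < m) (hb : FixedSizeBound G univ m δ t) :
    indepCount G t = indepCount (completeBip δ m) t ↔ Nonempty (G ≃g completeBip δ m) := by
  refine ⟨fun he => ?_, fun ⟨e⟩ => indepCount_congr e t⟩
  rw [indepCount_completeBip (by omega)] at he
  obtain ⟨F, ⟨e⟩⟩ := exists_iso_completeBipPlus hn h
    (hb.2 (by rw [← indepCount_eq_card_indepSets, he]))
  rw [indepCount_congr e, indepCount_completeBipPlus (by omega), Nat.add_left_cancel_iff] at he
  rw [eq_bot_of_indepCount_eq ht htδ he, completeBipPlus_bot] at e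
  exact ⟨e⟩

end Counting

theorem mainTheorem1 {V : Type*} [Fintype V] (G : SimpleGraph V) [DecidableRel G.Adj]
    (n δ t : ℕ) (hn : Fintype.card V = n) (hδ : G.minDegree = δ) :
    (δ = 2 → 3 ≤ t →
      indepCount G t ≤ indepCount (completeBip 2 (n - 2)) t ∧
      (5 ≤ n → t ≤ n - 2 →
        (indepCount G t = indepCount (completeBip 2 (n - 2)) t ↔
          Nonempty (G ≃g completeBip 2 (n - 2)) ∨
          Nonempty (G ≃g completeBipPlus (⊤ : SimpleGraph (Fin 2)) (n - 2))))) ∧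
    (δ = 3 → 3 ≤ t →
      indepCount G t ≤ indepCount (completeBip 3 (n - 3)) t ∧
      (6 ≤ n → t = 3 →
        (indepCount G t = indepCount (completeBip 3 (n - 3)) t ↔
          Nonempty (G ≃g completeBip 3 (n - 3)))) ∧
      (7 ≤ n → 4 ≤ t → t ≤ n - 3 →
        (indepCount G t = indepCount (completeBip 3 (n - 3)) t ↔
          ∃ F : SimpleGraph (Fin 3), Nonempty (G ≃g completeBipPlus F (n - 3))))) ∧
    (3 ≤ δ → 2 * δ + 1 ≤ t →
      indepCount G t ≤ indepCount (completeBip δ (n - δ)) t ∧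
      (3 * δ + 1 ≤ n → t ≤ n - δ →
        (indepCount G t = indepCount (completeBip δ (n - δ)) t ↔
          ∃ F : SimpleGraph (Fin δ), Nonempty (G ≃g completeBipPlus F (n - δ))))) := by
  have h : ∀ v, (nonNbrs G Finset.univ v).card < n - δ := fun v =>
    hn ▸ card_nonNbrs_univ_lt G hδ v
  have h' : ∀ v ∈ Finset.univ, (nonNbrs G Finset.univ v).card < n - δ := fun v _ => h v
  -- Subtraction is truncated; a positive t ≤ n - δ ensures that δ < n.
  have hcard : ∀ {t}, 1 ≤ t → t ≤ n - δ → Fintype.card V = n - δ + δ := by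
    intro t ht htm
    omega
  refine ⟨?_, ?_, ?_⟩
  · rintro rfl ht
    have hb : t ≤ n - 2 → FixedSizeBound G Finset.univ (n - 2) 2 t := fun htm =>
      fixedSizeBound_of_le_two (hcard (by omega) htm) le_rfl ht htm h'
    refine ⟨indepCount_le_completeBip (by omega) h hb, fun _ htm => ?_⟩
    rw [← exists_iso_completeBipPlus_two_iff]
    exact indepCount_eq_completeBip_iff (hcard (by omega) htm) (by omega) (by omega) h (hb htm)
  · rintro rfl ht
    have hb : t ≤ n - 3 → FixedSizeBound G Finset.univ (n - 3) 3 t := fun htm => by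
      rcases ht.eq_or_lt with rfl | ht'
      · exact fixedSizeBound_three (hcard (by omega) htm) htm htm h'
      · exact fixedSizeBound_of_eq_three (hcard (by omega) htm) ht' htm h'
    refine ⟨indepCount_le_completeBip (by omega) h hb, ?_, fun _ ht' htm => ?_⟩
    · rintro hn6 rfl
      have htm : 3 ≤ n - 3 := by omega
      exact indepCount_eq_completeBip_iff_of_le (hcard (by omega) htm) (by omega) le_rfl h (hb htm)
    · exact indepCount_eq_completeBip_iff (hcard (by omega) htm) (by omega) (by omega) h (hb htm)
  · intro hδ3 ht
    have hb : t ≤ n - δ → FixedSizeBound G Finset.univ (n - δ) δ t := fun htm =>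
      fixedSizeBound_of_two_mul_lt (hcard (by omega) htm) (by omega) (by omega) htm h'
    refine ⟨indepCount_le_completeBip (by omega) h hb, fun _ htm => ?_⟩
    exact indepCount_eq_completeBip_iff (hcard (by omega) htm) (by omega) (by omega) h (hb htm)
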